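/- **Proposition 3.1.** Let $\kappa$ be an algebraically closed field and let $G$ be a finite simple 3-regular three-connected planar graph, with a planar embedding (a combinatorial map of genus $0$: a cyclic order of the edge directions at every vertex, the faces being the orbits of face tracing, with $\#V-\#E+\#F=2$) and a chosen outer face $e$. Let $F$ be the set of faces. *The schön embedding.* Let $R=\kappa[x_f : f\in F\setminus\{e\}]$. For a vertex $v$ let $L_v\subset R$ be the ideal generated by the $x_f$ with $f\neq e$ not incident with $v$ and, if $v$ is not on the outer face, also by the sum of the variables of the faces incident with $v$. The schön embedding is the union of the lines defined by the $L_v$ in $\operatorname{Proj}(R)$, and $I_{sch}\subset R$ is its homogeneous vanishing ideal. *The dual complex.* Let $M$ be the simplicial complex on the vertex set $F$ in which a nonempty set of faces spans a simplex if and only if these faces have a common vertex of $G$. Let $I_M\subset S=\kappa[x_f: f\in F]$ be its Stanley–Reisner ideal, generated by the squarefree monomials whose support is not a simplex of $M$. Let $\phi: S\to R$ be the $\kappa$-algebra homomorphism that replaces $x_e$ by $-\sum_{f\in F,\,f\neq e}x_f$ and fixes the other variables. Then: 1. $M$ is the dual complex of the polytope of $G$: if a three-dimensional convex polytope $P\subset\mathbb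 R^3$ realizes the embedded graph (the vertices, edges and facets of $P$ are identified with the vertices, edges and faces of the embedding, with the same vertex–edge and vertex–face incidences), then a nonempty set of faces spans a simplex of $M$ if and only if the corresponding facets of $P$ have nonempty intersection. 2. The ideals $I_{sch}$ and $I_M+\langle\sum_{f\in F}x_f\rangle$ are radical, and $\phi^{-1}(I_{sch})=I_M+\langle\sum_{f\in F}x_f\rangle$. That is, the schön embedding is the Stanley–Reisner variety of $M$ intersected with the hyperplane $\sum_{f\in F}x_f=0$, and this hyperplane section is reduced. 3. The set $\mathcal G=\{\phi(m) : m \text{ a minimal monomial generator of } I_M\}$ is a minimal generating set of $I_{sch}$: it generates $I_{sch}$, and no proper subset of $\mathcal G$ does. -/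

import Mathlib

/-! ### Three-connected graphs and their planar embeddings -/

/-- `G` is three-(vertex-)connected: it has more than three vertices, and deleting at most two
vertices leaves a connected graph. -/
def SimpleGraph.IsThreeConnected {V : Type*} [Fintype V] (G : SimpleGraph V) : Prop :=
  3 < Fintype.card V ∧ ∀ S : Finset V, S.card < 3 → (G.induce {v | v ∉ S}).Connected

/-- The face-tracing permutation of a rotation `rot` of the darts (oriented edges): having walked
along the dart `d`, turn to the dart which follows the reversal of `d` in the rotation at the
endpoint of `d`. -/
def SimpleGraph.facePerm {V : Type*} {G : SimpleGraph V} (rot : Equiv.Perm G.Dart) :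
    Equiv.Perm G.Dart :=
  (Function.Involutive.toPerm SimpleGraph.Dart.symm SimpleGraph.Dart.symm_involutive).trans rot

/-- A planar embedding of a finite connected graph without isolated vertices, as a combinatorial
map (rotation system). The darts leaving each vertex are cyclically ordered by `rot`, the cycles of
`facePerm rot` are the boundary walks of the faces, and by Euler's formula
`#V - #E + #F = 2` the surface that carries the embedding is the sphere. The choice of an outer
face, which turns an embedding into the sphere into an embedding into the plane, is separate. -/
structure PlanarEmbedding {V : Type*} (G : SimpleGraph V) where
  /-- the next dart in the cyclic order around the initial vertex -/
  rot : Equiv.Perm G.Dart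
  /-- the cycles of `rot` are exactly the sets of darts with a common initial vertex -/
  sameCycle_iff : ∀ d d' : G.Dart, rot.SameCycle d d' ↔ d.fst = d'.fst
  /-- Euler's formula for the sphere -/
  euler : Nat.card V + Nat.card (Quotient (Equiv.Perm.SameCycle.setoid (SimpleGraph.facePerm rot)))
    = Nat.card G.edgeSet + 2

/-- The simplicial complex on `ι` whose faces are the nonempty finite sets of indices that are
incident with a common point. -/
def incidenceComplex {X ι : Type*} (inc : X → ι → Prop) (h : ∀ i, ∃ x, inc x i) :
    AbstractSimplicialComplex ι where
  faces := {s | s.Nonempty ∧ ∃ x, ∀ i ∈ s, inc x i}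
  isRelLowerSet_faces := fun _ hs =>
    ⟨hs.1, fun _ hts ht => ⟨ht, hs.2.imp fun _ hx i hi => hx i (hts hi)⟩⟩
  singleton_mem := fun i => ⟨Finset.singleton_nonempty i, by simpa using h i⟩

namespace PlanarEmbedding

variable {V : Type*} {G : SimpleGraph V} (E : PlanarEmbedding G)

/-- The faces of the embedding (including the outer one). -/
def Face : Type _ := Quotient (Equiv.Perm.SameCycle.setoid (SimpleGraph.facePerm E.rot))

/-- The face whose boundary walk contains the dart `d`. -/
def faceOf (d : G.Dart) : E.Face :=
  Quotient.mk (Equiv.Perm.SameCycle.setoid (SimpleGraph.facePerm E.rot)) d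

/-- The vertex `v` is incident with the face `f`: the boundary walk of `f` passes through `v`. -/
def Inc (v : V) (f : E.Face) : Prop := ∃ d : G.Dart, d.fst = v ∧ E.faceOf d = f

instance [Finite V] : Finite E.Face :=
  haveI : Finite G.Dart := Finite.of_injective _ SimpleGraph.Dart.toProd_injective
  inferInstanceAs (Finite (Quotient _))

noncomputable instance [Finite V] : Fintype E.Face := Fintype.ofFinite _

noncomputable instance : DecidableEq E.Face := Classical.decEq _

theorem exists_inc (f : E.Face) : ∃ v, E.Inc v f :=
  Quotient.inductionOn f fun d => ⟨d.fst, d, rfl, rfl⟩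

/-- The dual complex of the embedded graph: its vertices are the faces of the embedding, and a
nonempty set of them spans a simplex iff these faces have a common vertex of the graph. For the
embedding of a 3-regular three-connected graph as the boundary of a three-dimensional polytope `P`
this is the dual complex of `P`, see `Polytope3.dualComplex`. -/
def dualComplex : AbstractSimplicialComplex E.Face := incidenceComplex E.Inc E.exists_inc

end PlanarEmbedding

/-! ### Three-dimensional polytopes -/

namespace Polytope3

/-- `P` is a three-dimensional convex polytope in `ℝ³`. -/
def IsPolytope (P : Set (EuclideanSpace ℝ (Fin 3))) : Prop :=
  (∃ S : Set (EuclideanSpace ℝ (Fin 3)), S.Finite ∧ P = convexHull ℝ S) ∧ (interior P).Nonempty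

/-- `Q` is a facet (two-dimensional face) of `P`. -/
def IsFacet (P Q : Set (EuclideanSpace ℝ (Fin 3))) : Prop :=
  IsExposed ℝ P Q ∧ Module.finrank ℝ (vectorSpan ℝ Q) = 2

/-- The set of facets of `P`. -/
def Facet (P : Set (EuclideanSpace ℝ (Fin 3))) : Type := {Q // IsFacet P Q}

theorem Facet.nonempty {P : Set (EuclideanSpace ℝ (Fin 3))} (Q : Facet P) : Q.1.Nonempty := by
  by_contra h
  have h2 := Q.2.2
  rw [Set.not_nonempty_iff_eq_empty.mp h, vectorSpan_empty] at h2
  simp at h2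

/-- The dual complex of a simple polytope `P` (the boundary complex of the dual polytope): its
vertices are the facets of `P`, and a nonempty set of facets spans a simplex iff their intersection
is nonempty. -/
def dualComplex (P : Set (EuclideanSpace ℝ (Fin 3))) : AbstractSimplicialComplex (Facet P) :=
  incidenceComplex (fun x Q => x ∈ Q.1) Facet.nonempty

/-- The embedded graph `G` is the boundary of the polytope `P`: vertices and edges of `G` are those
of `P`, and the faces of the embedding are the facets of `P`, with the same incidences. -/
structure Realization {V : Type*} {G : SimpleGraph V} (E : PlanarEmbedding G)
    (P : Set (EuclideanSpace ℝ (Fin 3))) where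
  isPolytope : IsPolytope P
  vertex : V ≃ P.extremePoints ℝ
  adj_iff : ∀ u v : V, G.Adj u v ↔ u ≠ v ∧
    IsExposed ℝ P (segment ℝ (vertex u : EuclideanSpace ℝ (Fin 3)) (vertex v))
  facet : E.Face ≃ Facet P
  inc_iff : ∀ (v : V) (f : E.Face),
    E.Inc v f ↔ (vertex v : EuclideanSpace ℝ (Fin 3)) ∈ (facet f).1

end Polytope3

/-! ### Ideals of polynomials -/

section Ideals

variable {κ : Type*} [Field κ] {σ : Type*}

/-- The zero locus in projective space of an ideal. It is used for ideals generated by homogeneous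
polynomials, for which the choice of homogeneous coordinates `p.rep` is immaterial. -/
def projZeroLocus (I : Ideal (MvPolynomial σ κ)) : Set (Projectivization κ (σ → κ)) :=
  {p | ∀ q ∈ I, MvPolynomial.eval p.rep q = 0}

/-- The homogeneous vanishing ideal of a set of points of projective space. -/
noncomputable def projVanishingIdeal (Z : Set (Projectivization κ (σ → κ))) : Ideal (MvPolynomial σ κ) :=
  Ideal.span {q | (∃ n, q.IsHomogeneous n) ∧ ∀ p ∈ Z, MvPolynomial.eval p.rep q = 0}

/-- The Stanley–Reisner ideal of a simplicial complex, generated by the squarefree monomials whose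
support is not a face. (The empty set counts as a face of every complex, although it is not listed
in `M.faces`.) -/
noncomputable def stanleyReisnerIdeal (κ : Type*) [Field κ] (M : AbstractSimplicialComplex σ) :
    Ideal (MvPolynomial σ κ) :=
  Ideal.span {q | ∃ s : Finset σ, s.Nonempty ∧ s ∉ M ∧ q = ∏ i ∈ s, MvPolynomial.X i}

/-- The minimal monomial generators of a monomial ideal `I`: the monomials in `I` that are minimal
with respect to divisibility. -/
def minimalMonomialGenerators (I : Ideal (MvPolynomial σ κ)) : Set (MvPolynomial σ κ) :=
  {q | ∃ a : σ →₀ ℕ, Minimal (fun b : σ →₀ ℕ => MvPolynomial.monomial b (1 : κ) ∈ I) a ∧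
    q = MvPolynomial.monomial a 1}

/-- `S` generates the ideal `I`, and no proper subset of `S` does. -/
def IsMinimalGeneratingSet {R : Type*} [CommRing R] (S : Set R) (I : Ideal R) : Prop :=
  Minimal (fun T : Set R => Ideal.span T = I) S

end Ideals

/-! ### The schön embedding -/

namespace PlanarEmbedding

section Schon

variable (κ : Type*) [Field κ] {V : Type*} [Finite V] {G : SimpleGraph V}
  (E : PlanarEmbedding G) (e : E.Face)

/-- The faces other than the outer face `e`. -/
abbrev InteriorFace : Type _ := {f : E.Face // f ≠ e}

open Classical in
/-- The ideal `L_v` of linear forms attached to the vertex `v`. It is generated by the variables of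
the interior faces not incident with `v` and, if `v` is an interior vertex (not on the outer face
`e`), also by the sum of the variables of the interior faces incident with `v`. -/
noncomputable def lineIdeal (v : V) : Ideal (MvPolynomial (E.InteriorFace e) κ) :=
  if E.Inc v e then
    Ideal.span {q | ∃ f : E.InteriorFace e, ¬ E.Inc v f.1 ∧ q = MvPolynomial.X f}
  else
    Ideal.span ({q | ∃ f : E.InteriorFace e, ¬ E.Inc v f.1 ∧ q = MvPolynomial.X f} ∪
      {∑ f : E.InteriorFace e with E.Inc v f.1,
        (MvPolynomial.X f : MvPolynomial (E.InteriorFace e) κ)})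

/-- The schön embedding of the graph curve: the arrangement of the lines defined by the `L_v`, in
the projective space with one homogeneous coordinate for each interior face. -/
def schonEmbedding : Set (Projectivization κ (E.InteriorFace e → κ)) :=
  ⋃ v : V, projZeroLocus (E.lineIdeal κ e v)

/-- The radical defining ideal of the schön embedding. -/
noncomputable def schonIdeal : Ideal (MvPolynomial (E.InteriorFace e) κ) :=
  projVanishingIdeal (E.schonEmbedding κ e)

/-- The substitution that replaces the variable of the outer face `e` by minus the sum of the
variables of all other faces. Its kernel is generated by the sum of all face variables, so it
identifies the projective space of the schön embedding with the hyperplane `∑ f, x_f = 0`. -/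
noncomputable def outerSubst :
    MvPolynomial E.Face κ →ₐ[κ] MvPolynomial (E.InteriorFace e) κ :=
  MvPolynomial.aeval fun f =>
    if h : f = e then -∑ f' : E.InteriorFace e, MvPolynomial.X f' else MvPolynomial.X ⟨f, h⟩

end Schon

end PlanarEmbedding

/-! Write `l` for the sum of all face variables and `C_v` for the ideal generated by the variables
of the faces not incident with `v`. A squarefree monomial is a non-face exactly when it lies in
every `C_v`, so the Stanley–Reisner ideal is `⋂ C_v`. The substitution identifies the ambient
projective space with the hyperplane `l = 0`, and the line of `v` with the zero set of `C_v + (l)`.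
Over an infinite field `C_v + (l)` contains every polynomial vanishing there, so the preimage of the
schön ideal is `⋂ (C_v + (l))`.

The crux is `⋂ (C_v + (l)) = (⋂ C_v) + (l)`, whose nontrivial inclusion is
`iInf_coordIdeal_sup_sum_le`. If `g ≡ l * h_v` modulo `C_v`, the quotients `h_v` agree on overlaps
of the coordinate subspaces, because `l` can be cancelled there; connectedness of the graph makes
their constant terms agree as well. They glue to one polynomial `H`, and `g - l * H` lies in every
`C_v`. Radicality follows because the schön ideal is a vanishing ideal.

For minimality, `l` is a nonzerodivisor modulo the Stanley–Reisner ideal and has no constant term,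
so a redundant generator after substitution would already be redundant before
(`isMinimalGeneratingSet_image_minimalMonomialGenerators`). -/

namespace MvPolynomial

/-! ### Coordinate subspaces and division by the sum of the variables -/

variable {κ : Type*} [Field κ] {σ : Type*}

/-- A polynomial is congruent to the result of a substitution that respects the congruence. -/
theorem sub_aeval_mem (I : Ideal (MvPolynomial σ κ)) (g : σ → MvPolynomial σ κ)
    (hg : ∀ i, X i - g i ∈ I) (p : MvPolynomial σ κ) : p - aeval g p ∈ I := by
  have h : Ideal.Quotient.mkₐ κ I = (Ideal.Quotient.mkₐ κ I).comp (aeval g) := by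
    ext i
    simpa using Ideal.Quotient.eq.mpr (hg i)
  exact Ideal.Quotient.eq.mp (DFunLike.congr_fun h p)

/-- The ideal of the coordinate subspace spanned by the coordinates in `A`. -/
noncomputable def coordIdeal (κ : Type*) [Field κ] {σ : Type*} (A : Set σ) :
    Ideal (MvPolynomial σ κ) :=
  Ideal.span (X '' Aᶜ)

theorem mem_coordIdeal {A : Set σ} {p : MvPolynomial σ κ} :
    p ∈ coordIdeal κ A ↔ ∀ a : σ →₀ ℕ, (a.support : Set σ) ⊆ A → coeff a p = 0 := by
  rw [coordIdeal, mem_ideal_span_X_image]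
  refine forall_congr' fun a => ?_
  rw [mem_support_iff, ← not_imp_not, not_not, Set.subset_def]
  refine imp_congr_left ?_
  simp only [not_exists, not_and, Set.mem_compl_iff, Finset.mem_coe, Finsupp.mem_support_iff]
  exact forall_congr' fun i => not_imp_not

-- Killing the variables outside `A` changes a polynomial only modulo the ideal. Being the kernel of
-- a map into a domain, the ideal is prime, which is how `l` gets cancelled later.
open Classical in
theorem mem_coordIdeal_iff_aeval {A : Set σ} {p : MvPolynomial σ κ} :
    p ∈ coordIdeal κ A ↔
      aeval (fun i => if i ∈ A then (X i : MvPolynomial σ κ) else 0) p = 0 := by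
  constructor
  · intro hp
    suffices coordIdeal κ A ≤ RingHom.ker
        (aeval (fun i => if i ∈ A then (X i : MvPolynomial σ κ) else 0)) from this hp
    rw [coordIdeal, Ideal.span_le]
    rintro _ ⟨i, hi, rfl⟩
    have hi' : i ∉ A := hi
    simp [hi']
  · intro hp
    have h := sub_aeval_mem (coordIdeal κ A) (fun i => if i ∈ A then X i else 0) (fun i => ?_) p
    · rwa [hp, sub_zero] at h
    · by_cases hi : i ∈ A
      · simp [hi]
      · have hX : (X i : MvPolynomial σ κ) ∈ coordIdeal κ A :=
          Ideal.subset_span (Set.mem_image_of_mem X hi)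
        simpa [hi] using hX

theorem mem_coordIdeal_of_mul_mem {A : Set σ} {p q : MvPolynomial σ κ}
    (hpq : p * q ∈ coordIdeal κ A) (hp : p ∉ coordIdeal κ A) : q ∈ coordIdeal κ A := by
  rw [mem_coordIdeal_iff_aeval] at *
  rw [map_mul] at hpq
  exact (mul_eq_zero.mp hpq).resolve_left hp

theorem coordIdeal_mono {A B : Set σ} (h : A ⊆ B) : coordIdeal κ B ≤ coordIdeal κ A :=
  fun _ hp => mem_coordIdeal.mpr fun a ha => mem_coordIdeal.mp hp a (ha.trans h)

variable [Fintype σ]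

theorem sum_X_notMem_coordIdeal {A : Set σ} (hA : A.Nonempty) :
    (∑ i, X i : MvPolynomial σ κ) ∉ coordIdeal κ A := by
  classical
  obtain ⟨j, hj⟩ := hA
  intro h
  have := mem_coordIdeal.mp h (Finsupp.single j 1) (by
    intro i hi
    simp only [Finset.mem_coe, Finsupp.mem_support_iff, Finsupp.single_apply] at hi
    split_ifs at hi with hji
    · exact hji ▸ hj
    · exact absurd rfl hi)
  simp [coeff_sum, coeff_X, Finsupp.single_left_inj] at this

/-- On a connected union of coordinate subspaces, a polynomial that is divisible by the sum of the
variables on each subspace is divisible by it on the union. -/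
theorem iInf_coordIdeal_sup_sum_le {ι : Type*} [Finite ι] (A : ι → Set σ)
    (hconn : ∀ v w, Relation.ReflTransGen (fun v w => (A v ∩ A w).Nonempty) v w) :
    ⨅ v, (coordIdeal κ (A v) ⊔ Ideal.span {∑ i, X i}) ≤
      (⨅ v, coordIdeal κ (A v)) ⊔ Ideal.span {∑ i, X i} := by
  classical
  intro g hg
  set l : MvPolynomial σ κ := ∑ i, X i with hl
  have hq : ∀ v, ∃ h, g - l * h ∈ coordIdeal κ (A v) := by
    intro v
    obtain ⟨y, hy, z, hz, rfl⟩ := Submodule.mem_sup.mp (Ideal.mem_iInf.mp hg v)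
    obtain ⟨h, rfl⟩ := Ideal.mem_span_singleton'.mp hz
    exact ⟨h, by simpa [mul_comm] using hy⟩
  choose h hh using hq
  -- On the overlap both `l * h v` and `l * h w` are congruent to `g`; cancel `l`.
  have agree : ∀ v w, (A v ∩ A w).Nonempty → h v - h w ∈ coordIdeal κ (A v ∩ A w) := by
    intro v w hvw
    refine mem_coordIdeal_of_mul_mem ?_ (sum_X_notMem_coordIdeal hvw)
    have h1 := coordIdeal_mono (Set.inter_subset_left (t := A w)) (hh v)
    have h2 := coordIdeal_mono (Set.inter_subset_right (s := A v)) (hh w)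
    convert Ideal.sub_mem _ h2 h1 using 1
    ring
  -- Disjoint `A v` and `A w` share only the monomial 1, where `agree` says nothing; a chain of
  -- overlapping sets compares the constant terms.
  have const : ∀ v w, coeff 0 (h v) = coeff 0 (h w) := by
    intro v w
    induction hconn v w with
    | refl => rfl
    | tail _ hab ih =>
      rw [ih, ← sub_eq_zero, ← coeff_sub]
      exact mem_coordIdeal.mp (agree _ _ hab) 0 (by simp)
  have compat : ∀ v w (a : σ →₀ ℕ), (a.support : Set σ) ⊆ A v → (a.support : Set σ) ⊆ A w →
      coeff a (h v) = coeff a (h w) := by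
    intro v w a hv hw
    rcases eq_or_ne a 0 with rfl | ha
    · exact const v w
    · obtain ⟨i, hi⟩ := Finsupp.support_nonempty_iff.mpr ha
      rw [← sub_eq_zero, ← coeff_sub]
      exact mem_coordIdeal.mp (agree v w ⟨i, hv hi, hw hi⟩) a (Set.subset_inter hv hw)
  cases nonempty_fintype ι
  -- The coefficients of the glued quotient. A monomial supported in no `A v` lies in every ideal,
  -- so its value 0 is arbitrary.
  let c : (σ →₀ ℕ) → κ := fun a =>
    if hx : ∃ v, (a.support : Set σ) ⊆ A v then coeff a (h hx.choose) else 0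
  have hc : ∀ v (a : σ →₀ ℕ), (a.support : Set σ) ⊆ A v → c a = coeff a (h v) := by
    intro v a hv
    have hx : ∃ v, (a.support : Set σ) ⊆ A v := ⟨v, hv⟩
    simpa only [c, dif_pos hx] using compat _ v a hx.choose_spec hv
  let H : MvPolynomial σ κ :=
    ∑ a ∈ Finset.univ.biUnion fun v => (h v).support, monomial a (c a)
  have hH : ∀ v, H - h v ∈ coordIdeal κ (A v) := by
    intro v
    refine mem_coordIdeal.mpr fun a ha => ?_
    rw [coeff_sub, sub_eq_zero]
    simp only [H, coeff_sum, coeff_monomial, Finset.sum_ite_eq']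
    split_ifs with hmem
    · exact hc v a ha
    · by_contra hne
      exact hmem (Finset.mem_biUnion.mpr
        ⟨v, Finset.mem_univ v, mem_support_iff.mpr (Ne.symm hne)⟩)
  refine Submodule.mem_sup.mpr ⟨g - l * H, Ideal.mem_iInf.mpr fun v => ?_, l * H,
    Ideal.mul_mem_right _ _ (Ideal.mem_span_singleton_self l), by ring⟩
  convert Ideal.sub_mem _ (hh v) (Ideal.mul_mem_left _ l (hH v)) using 1
  ring

end MvPolynomial

open MvPolynomial

/-! ### Monomial ideals and their minimal generators -/

section StanleyReisner

variable {κ : Type*} [Field κ] {σ X' : Type*}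

/-- The Stanley–Reisner ideal is the intersection of the ideals of the coordinate subspaces that
correspond to the facets. -/
theorem stanleyReisnerIdeal_incidenceComplex [Nonempty X'] (inc : X' → σ → Prop)
    (h : ∀ i, ∃ x, inc x i) :
    stanleyReisnerIdeal κ (incidenceComplex inc h) = ⨅ x, coordIdeal κ {i | inc x i} := by
  apply le_antisymm
  · rw [stanleyReisnerIdeal, Ideal.span_le]
    rintro _ ⟨s, hs, hsM, rfl⟩
    refine Ideal.mem_iInf.mpr fun x => ?_
    have : ∃ i ∈ s, ¬ inc x i := by
      by_contra! hcon
      exact hsM ⟨hs, x, hcon⟩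
    obtain ⟨i, his, hi⟩ := this
    exact Ideal.mem_of_dvd _ (Finset.dvd_prod_of_mem _ his)
      (Ideal.subset_span (Set.mem_image_of_mem X hi))
  · intro p hp
    rw [p.as_sum]
    refine Ideal.sum_mem _ fun a ha => ?_
    have hna : ∀ x, ∃ i ∈ a.support, ¬ inc x i := by
      intro x
      by_contra! hcon
      exact mem_support_iff.mp ha (mem_coordIdeal.mp (Ideal.mem_iInf.mp hp x) a hcon)
    have hdvd : (∏ i ∈ a.support, X i : MvPolynomial σ κ) ∣ monomial a (coeff a p) := by
      rw [monomial_eq]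
      exact Dvd.dvd.mul_left (Finset.prod_dvd_prod_of_dvd _ _ fun i hi =>
        dvd_pow_self _ (Finsupp.mem_support_iff.mp hi)) _
    refine Ideal.mem_of_dvd _ hdvd (Ideal.subset_span ⟨a.support, ?_, ?_, rfl⟩)
    · obtain ⟨i, hi, -⟩ := hna (Classical.arbitrary X')
      exact ⟨i, hi⟩
    · rintro ⟨-, x, hx⟩
      obtain ⟨i, hi, hix⟩ := hna x
      exact hix (hx i hi)

theorem monomial_mem_iInf_coordIdeal {ι : Type*} {A : ι → Set σ} {p : MvPolynomial σ κ}
    (hp : p ∈ ⨅ v, coordIdeal κ (A v)) {a : σ →₀ ℕ} (ha : a ∈ p.support) :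
    monomial a 1 ∈ ⨅ v, coordIdeal κ (A v) := by
  classical
  refine Ideal.mem_iInf.mpr fun v => mem_coordIdeal.mpr fun b hb => ?_
  rw [coeff_monomial, if_neg]
  rintro rfl
  exact mem_support_iff.mp ha (mem_coordIdeal.mp (Ideal.mem_iInf.mp hp v) a hb)

theorem sum_X_mul_mem_iInf_coordIdeal [Fintype σ] {ι : Type*} {A : ι → Set σ}
    (hA : ∀ v, (A v).Nonempty) {p : MvPolynomial σ κ}
    (hp : (∑ i, X i) * p ∈ ⨅ v, coordIdeal κ (A v)) : p ∈ ⨅ v, coordIdeal κ (A v) :=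
  Ideal.mem_iInf.mpr fun v => mem_coordIdeal_of_mul_mem (Ideal.mem_iInf.mp hp v)
    (sum_X_notMem_coordIdeal (hA v))

/-- With finitely many variables, divisibility of monomials is well-founded, so each monomial of `I`
has a minimal divisor in `I`. -/
theorem span_minimalMonomialGenerators [Finite σ] {I : Ideal (MvPolynomial σ κ)}
    (hI : ∀ p ∈ I, ∀ a ∈ p.support, monomial a 1 ∈ I) :
    Ideal.span (minimalMonomialGenerators I) = I := by
  apply le_antisymm
  · rw [Ideal.span_le]
    rintro _ ⟨a, ha, rfl⟩
    exact ha.prop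
  · intro p hp
    rw [p.as_sum]
    refine Ideal.sum_mem _ fun a ha => ?_
    obtain ⟨b, hba, hb⟩ := exists_minimal_le_of_wellFoundedLT
      (fun b : σ →₀ ℕ => monomial b (1 : κ) ∈ I) a (hI p hp a ha)
    exact Ideal.mem_of_dvd _ (monomial_dvd_monomial.mpr ⟨Or.inr hba, one_dvd _⟩)
      (Ideal.subset_span ⟨b, hb, rfl⟩)

/-- The minimal generators of a monomial ideal stay a minimal generating set modulo a
nonzerodivisor without constant term. -/
theorem isMinimalGeneratingSet_image_minimalMonomialGenerators [Finite σ] {R : Type*} [CommRing R]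
    [Algebra κ R] {I : Ideal (MvPolynomial σ κ)} (hI : ∀ p ∈ I, ∀ a ∈ p.support, monomial a 1 ∈ I)
    {l : MvPolynomial σ κ} (hl : coeff 0 l = 0) (hreg : ∀ q, l * q ∈ I → q ∈ I)
    (φ : MvPolynomial σ κ →ₐ[κ] R) (hφ : Function.Surjective φ) (hker : ∀ q, φ q = 0 → l ∣ q) :
    IsMinimalGeneratingSet (φ '' minimalMonomialGenerators I) (I.map φ) := by
  refine ⟨(Ideal.map_span φ _).symm.trans (by rw [span_minimalMonomialGenerators hI]), ?_⟩
  rintro T hT hTS _ ⟨_, ⟨a, ha, rfl⟩, rfl⟩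
  by_contra hmT
  -- Exponents of the other minimal generators. The aim is a multiple of `x^a` in `J` that still
  -- contains the monomial `x^a`.
  let B : Set (σ →₀ ℕ) := {b | Minimal (fun b => monomial b (1 : κ) ∈ I) b ∧ b ≠ a}
  let J : Ideal (MvPolynomial σ κ) := Ideal.span ((fun b => monomial b 1) '' B)
  have hJI : J ≤ I := by
    rw [Ideal.span_le]
    rintro _ ⟨b, hb, rfl⟩
    exact hb.1.prop
  have hTJ : Ideal.span T ≤ J.map φ := by
    rw [Ideal.span_le]
    intro t ht
    obtain ⟨_, ⟨b, hb, rfl⟩, rfl⟩ := hTS ht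
    refine Ideal.mem_map_of_mem φ (Ideal.subset_span ⟨b, ⟨hb, ?_⟩, rfl⟩)
    rintro rfl
    exact hmT ht
  have hm : φ (monomial a 1) ∈ J.map φ := hTJ (hT ▸ Ideal.mem_map_of_mem φ ha.prop)
  obtain ⟨j, hj, hjφ⟩ := (Ideal.mem_map_iff_of_surjective φ hφ).mp hm
  obtain ⟨h, hh⟩ := hker (monomial a 1 - j) (by rw [map_sub, hjφ, sub_self])
  have hhI : h ∈ I := hreg h (hh ▸ Ideal.sub_mem _ ha.prop (hJI hj))
  have hIle : I ≤ Ideal.span (insert (monomial a 1) ((fun b => monomial b 1) '' B)) := by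
    conv_lhs => rw [← span_minimalMonomialGenerators hI]
    refine Ideal.span_mono ?_
    rintro _ ⟨b, hb, rfl⟩
    rcases eq_or_ne b a with rfl | hba
    · exact Set.mem_insert _ _
    · exact Set.mem_insert_of_mem _ ⟨b, ⟨hb, hba⟩, rfl⟩
  obtain ⟨b, z, hz, rfl⟩ := Ideal.mem_span_insert.mp (hIle hhI)
  -- Here `x^a - j = l * h` with `h = b * x^a + z` and `j`, `z` in `J`. Since `l` has no constant
  -- term, the coefficient of `x^a` in the product is 1, so a generator of the monomial ideal `J`
  -- divides `x^a`.
  have hmem : monomial a 1 * (1 - l * b) ∈ J := by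
    have : monomial a 1 * (1 - l * b) = j + l * z := by linear_combination hh
    exact this ▸ Ideal.add_mem _ hj (Ideal.mul_mem_left _ l hz)
  have hcoeff : coeff a (monomial a 1 * (1 - l * b)) = (1 : κ) := by
    have := coeff_monomial_mul (0 : σ →₀ ℕ) a (1 : κ) (1 - l * b)
    rw [add_zero] at this
    rw [this, ← constantCoeff_eq, map_sub, map_mul, constantCoeff_eq, hl]
    simp
  obtain ⟨c, hc, hca⟩ := mem_ideal_span_monomial_image.mp hmem a
    (mem_support_iff.mpr (by rw [hcoeff]; exact one_ne_zero))
  exact hc.2 (le_antisymm hca (ha.le_of_le hc.1.prop hca))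

end StanleyReisner

/-! ### Vanishing on a coordinate subspace cut by the hyperplane -/

namespace MvPolynomial

variable {κ : Type*} [Field κ] {σ : Type*}

theorem IsHomogeneous.eval_smul {p : MvPolynomial σ κ} {n : ℕ} (hp : p.IsHomogeneous n) (c : κ)
    (x : σ → κ) : eval (c • x) p = c ^ n * eval x p := by
  rw [eval_eq, eval_eq, Finset.mul_sum]
  refine Finset.sum_congr rfl fun a ha => ?_
  have hn : ∑ i ∈ a.support, a i = n := by
    exact (hp.degree_eq_sum_deg_support ha).symm
  simp only [Pi.smul_apply, smul_eq_mul, mul_pow, Finset.prod_mul_distrib, Finset.prod_pow_eq_pow_sum,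
    hn]
  ring

/-- The ideal of a coordinate subspace intersected with the hyperplane on which the sum of the
coordinates vanishes. -/
theorem mem_coordIdeal_sup_sum_iff [Infinite κ] [Fintype σ] {A : Set σ} (hA : A.Nonempty)
    {p : MvPolynomial σ κ} :
    p ∈ coordIdeal κ A ⊔ Ideal.span {∑ i, X i} ↔
      ∀ y : σ → κ, (∀ i, i ∉ A → y i = 0) → ∑ i, y i = 0 → eval y p = 0 := by
  classical
  constructor
  · intro hp y hy hsum
    suffices coordIdeal κ A ⊔ Ideal.span {∑ i, X i} ≤ RingHom.ker (eval y) from this hp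
    rw [coordIdeal, sup_le_iff, Ideal.span_le, Ideal.span_le]
    refine ⟨?_, ?_⟩
    · rintro _ ⟨i, hi, rfl⟩
      simpa using hy i hi
    · simpa using hsum
  · intro hp
    obtain ⟨i₀, hi₀⟩ := hA
    let l : MvPolynomial σ κ := ∑ i, X i
    let kill : MvPolynomial σ κ →ₐ[κ] MvPolynomial σ κ := aeval fun i => if i ∈ A then X i else 0
    -- After `kill`, this is a linear projection onto the vectors supported on `A` with coordinate
    -- sum 0: the coordinate `i₀` absorbs the sum. Composed with it, `p` vanishes at every point,
    -- hence is zero over an infinite field.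
    let u : σ → MvPolynomial σ κ := fun i => X i - if i = i₀ then l else 0
    have hkill : ∀ q, q - kill q ∈ coordIdeal κ A := by
      intro q
      rw [mem_coordIdeal_iff_aeval, map_sub, sub_eq_zero]
      change kill q = kill (kill q)
      have : kill = kill.comp kill := by
        ext i
        by_cases hi : i ∈ A <;> simp [kill, hi]
      exact DFunLike.congr_fun this q
    have hsub := sub_aeval_mem (coordIdeal κ A ⊔ Ideal.span {l}) (fun i => kill (u i)) (fun i => by
      have h1 : u i - kill (u i) ∈ coordIdeal κ A ⊔ Ideal.span {l} :=
        Ideal.mem_sup_left (hkill (u i))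
      have h2 : (if i = i₀ then l else 0) ∈ coordIdeal κ A ⊔ Ideal.span {l} := by
        split_ifs
        · exact Ideal.mem_sup_right (Ideal.mem_span_singleton_self l)
        · exact Ideal.zero_mem _
      convert Ideal.add_mem _ h1 h2 using 1
      simp only [u]
      ring) p
    suffices aeval (fun i => kill (u i)) p = 0 by rwa [this, sub_zero] at hsub
    refine MvPolynomial.funext fun z => ?_
    let zA : σ → κ := fun i => if i ∈ A then z i else 0
    have hz : ∀ q, eval z (kill q) = eval zA q := by
      intro q
      have : (aeval z).comp kill = aeval zA := by
        ext i
        by_cases hi : i ∈ A <;> simp [kill, zA, hi]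
      simpa [aeval_eq_eval] using DFunLike.congr_fun this q
    have hy : eval z (aeval (fun i => kill (u i)) p) = eval (fun i => eval zA (u i)) p := by
      have : (aeval z).comp (aeval fun i => kill (u i)) = aeval fun i => eval zA (u i) := by
        ext i
        simpa [aeval_eq_eval] using hz (u i)
      simpa [aeval_eq_eval] using DFunLike.congr_fun this p
    rw [hy, map_zero]
    apply hp
    · intro i hi
      have : i ≠ i₀ := fun h => hi (h ▸ hi₀)
      simp [u, zA, hi, this]
    · simp [u, l, apply_ite (eval zA)]

end MvPolynomial

open MvPolynomial

/-! ### The schön embedding inside the hyperplane -/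

namespace PlanarEmbedding

section Schon

variable {κ : Type*} [Field κ] {V : Type*} [Finite V] {G : SimpleGraph V}
  (E : PlanarEmbedding G) (e : E.Face)

/-- The point of the hyperplane on which the coordinates sum to zero with the given interior
coordinates. -/
noncomputable def extendPoint (x : E.InteriorFace e → κ) : E.Face → κ := fun f =>
  if h : f = e then -∑ f', x f' else x ⟨f, h⟩

theorem extendPoint_outer (x : E.InteriorFace e → κ) : E.extendPoint e x e = -∑ f', x f' := by
  simp [extendPoint]

theorem extendPoint_interior (x : E.InteriorFace e → κ) (f : E.InteriorFace e) :
    E.extendPoint e x f = x f := by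
  simp [extendPoint, f.2]

theorem sum_eq_outer_add {M : Type*} [AddCommMonoid M] (y : E.Face → M) :
    ∑ f, y f = y e + ∑ f : E.InteriorFace e, y f := by
  rw [← Fintype.sum_subtype_add_sum_subtype (fun f => f = e) y]
  congr 1
  convert Fintype.sum_subsingleton (fun f : {f : E.Face // f = e} => y f) ⟨e, rfl⟩

theorem sum_extendPoint (x : E.InteriorFace e → κ) : ∑ f, E.extendPoint e x f = 0 := by
  rw [E.sum_eq_outer_add e, extendPoint_outer]
  simp only [extendPoint_interior]
  exact neg_add_cancel _

theorem extendPoint_restrict {y : E.Face → κ} (hy : ∑ f, y f = 0) :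
    E.extendPoint e (fun f => y f) = y := by
  funext f
  by_cases hf : f = e
  · subst hf
    rw [E.sum_eq_outer_add f] at hy
    rw [extendPoint_outer]
    exact (eq_neg_of_add_eq_zero_left hy).symm
  · exact E.extendPoint_interior e _ ⟨f, hf⟩

theorem extendPoint_smul (c : κ) (x : E.InteriorFace e → κ) :
    E.extendPoint e (c • x) = c • E.extendPoint e x := by
  funext f
  by_cases hf : f = e
  · simp [extendPoint, hf, Finset.mul_sum]
  · simp [extendPoint, hf]

theorem outerSubst_X_interior (f : E.InteriorFace e) : E.outerSubst κ e (X f.1) = X f := by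
  simp [outerSubst, f.2]

theorem outerSubst_X_outer : E.outerSubst κ e (X e) = -∑ f, X f := by
  simp [outerSubst]

theorem eval_outerSubst (x : E.InteriorFace e → κ) (p : MvPolynomial E.Face κ) :
    eval x (E.outerSubst κ e p) = eval (E.extendPoint e x) p := by
  have : (aeval x).comp (E.outerSubst κ e) = aeval (E.extendPoint e x) := by
    ext f
    by_cases hf : f = e
    · subst hf
      simp [outerSubst_X_outer, extendPoint_outer]
    · simp [outerSubst, extendPoint, hf]
  simpa [aeval_eq_eval] using DFunLike.congr_fun this p

theorem outerSubst_sum : E.outerSubst κ e (∑ f, X f) = 0 := by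
  rw [map_sum, E.sum_eq_outer_add e, outerSubst_X_outer]
  simp only [outerSubst_X_interior]
  exact neg_add_cancel _

theorem outerSubst_surjective : Function.Surjective (E.outerSubst κ e) := by
  intro q
  refine ⟨rename Subtype.val q, ?_⟩
  have : (E.outerSubst κ e).comp (rename Subtype.val) = AlgHom.id κ _ := by
    ext1 f
    simp [outerSubst_X_interior]
  exact DFunLike.congr_fun this q

/-- Substituting and then including the interior variables again changes each variable by 0 or by
`l`, so `p` is congruent modulo `l` to the lift of its image. -/
theorem sum_dvd_of_outerSubst_eq_zero {p : MvPolynomial E.Face κ} (hp : E.outerSubst κ e p = 0) :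
    ∑ f, X f ∣ p := by
  have h := sub_aeval_mem (Ideal.span {∑ f, (X f : MvPolynomial E.Face κ)})
    (fun f => rename Subtype.val (E.outerSubst κ e (X f))) (fun f => ?_) p
  · have h0 : aeval (fun f => rename Subtype.val (E.outerSubst κ e (X f))) p =
        rename Subtype.val (E.outerSubst κ e p) := by
      have : aeval (fun f => rename Subtype.val (E.outerSubst κ e (X f))) =
          (rename Subtype.val).comp (E.outerSubst κ e) := by
        ext1 f
        simp
      rw [this]
      rfl
    rwa [h0, hp, map_zero, sub_zero, Ideal.mem_span_singleton] at h
  · by_cases hf : f = e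
    · subst hf
      have : X f - rename Subtype.val (E.outerSubst κ f (X f)) =
          ∑ g, (X g : MvPolynomial E.Face κ) := by
        rw [outerSubst_X_outer, E.sum_eq_outer_add f]
        simp
      exact this ▸ Ideal.mem_span_singleton_self _
    · have := E.outerSubst_X_interior (κ := κ) e ⟨f, hf⟩
      simp only at this
      simp [this]

/-- The extra generator for an interior vertex says that the outer coordinate vanishes too. In the
hyperplane all vertices are therefore treated alike. -/
theorem forall_lineIdeal_eval_eq_zero_iff (v : V) (x : E.InteriorFace e → κ) :
    (∀ q ∈ E.lineIdeal κ e v, eval x q = 0) ↔ ∀ f, ¬ E.Inc v f → E.extendPoint e x f = 0 := by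
  classical
  have hspan : ∀ S : Set (MvPolynomial (E.InteriorFace e) κ),
      (∀ q ∈ Ideal.span S, eval x q = 0) ↔ ∀ q ∈ S, eval x q = 0 := fun S =>
    Ideal.span_le (I := RingHom.ker (eval x))
  have hsplit : (∀ f, ¬ E.Inc v f → E.extendPoint e x f = 0) ↔
      (∀ f : E.InteriorFace e, ¬ E.Inc v f → x f = 0) ∧ (¬ E.Inc v e → ∑ f, x f = 0) := by
    constructor
    · intro h
      exact ⟨fun f hf => E.extendPoint_interior e x f ▸ h f hf, fun he => by
        simpa [extendPoint_outer] using h e he⟩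
    · rintro ⟨h1, h2⟩ f hf
      by_cases hfe : f = e
      · subst hfe
        rw [extendPoint_outer, h2 hf, neg_zero]
      · exact (E.extendPoint_interior e x ⟨f, hfe⟩).trans (h1 ⟨f, hfe⟩ hf)
  have hvars : (∀ q ∈ {q : MvPolynomial (E.InteriorFace e) κ |
      ∃ f : E.InteriorFace e, ¬ E.Inc v f.1 ∧ q = X f}, eval x q = 0) ↔
      ∀ f : E.InteriorFace e, ¬ E.Inc v f → x f = 0 := by
    constructor
    · intro h f hf
      simpa using h (X f) ⟨f, hf, rfl⟩
    · rintro h _ ⟨f, hf, rfl⟩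
      simpa using h f hf
  rw [hsplit, lineIdeal]
  split_ifs with he
  · rw [hspan, hvars]
    simp [he]
  · rw [hspan]
    simp only [Set.mem_union, or_imp, forall_and, hvars, Set.mem_singleton_iff, forall_eq]
    refine and_congr_right fun h => ?_
    rw [map_sum, Finset.sum_filter, imp_iff_right he]
    simp only [eval_X]
    rw [Finset.sum_congr rfl fun f _ => ite_eq_left_iff.mpr fun hf => (h f hf).symm]

/-- The affine cone over the schön embedding. -/
def schonCone (κ : Type*) [Field κ] : Set (E.InteriorFace e → κ) :=
  {x | ∃ v, ∀ f, ¬ E.Inc v f → E.extendPoint e x f = 0}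

theorem smul_mem_schonCone {x : E.InteriorFace e → κ} (hx : x ∈ E.schonCone e κ) (c : κ) :
    c • x ∈ E.schonCone e κ := by
  obtain ⟨v, hv⟩ := hx
  exact ⟨v, fun f hf => by rw [extendPoint_smul, Pi.smul_apply, hv f hf, smul_zero]⟩

theorem mem_schonEmbedding_iff (p : Projectivization κ (E.InteriorFace e → κ)) :
    p ∈ E.schonEmbedding κ e ↔ p.rep ∈ E.schonCone e κ := by
  simp only [schonEmbedding, Set.mem_iUnion, schonCone, Set.mem_ofPred_eq]
  exact exists_congr fun v => E.forall_lineIdeal_eval_eq_zero_iff e v p.rep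

theorem comap_vanishingIdeal_schonCone [Infinite κ] (hinc : ∀ v, ∃ f, E.Inc v f) :
    (vanishingIdeal κ (E.schonCone e κ)).comap (E.outerSubst κ e) =
      ⨅ v, (coordIdeal κ {f | E.Inc v f} ⊔ Ideal.span {∑ f, X f}) := by
  ext p
  simp only [Ideal.mem_comap, mem_vanishingIdeal_iff, Ideal.mem_iInf, aeval_eq_eval,
    eval_outerSubst]
  simp only [fun v => mem_coordIdeal_sup_sum_iff (κ := κ) (A := {f | E.Inc v f}) (p := p) (hinc v)]
  constructor
  · intro h v y hy hsum
    have := h (fun f => y f) ⟨v, by rwa [E.extendPoint_restrict e hsum]⟩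
    rwa [E.extendPoint_restrict e hsum] at this
  · rintro h x ⟨v, hv⟩
    exact h v _ hv (E.sum_extendPoint e x)

theorem exists_ne_zero_mem_schonCone {v : V} {f g : E.Face} (hfg : f ≠ g) (hf : E.Inc v f)
    (hg : E.Inc v g) : ∃ x ∈ E.schonCone e κ, x ≠ 0 := by
  let y : E.Face → κ := Pi.single f 1 - Pi.single g 1
  have hy : ∑ h, y h = 0 := by simp [y]
  refine ⟨fun h => y h, ⟨v, ?_⟩, ?_⟩
  · rw [E.extendPoint_restrict e hy]
    intro h hh
    have h1 : h ≠ f := fun H => hh (H ▸ hf)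
    have h2 : h ≠ g := fun H => hh (H ▸ hg)
    simp [y, h1, h2]
  · intro h0
    have h1 := congrFun (E.extendPoint_restrict e hy) f
    rw [h0, ← zero_smul κ (0 : E.InteriorFace e → κ), extendPoint_smul] at h1
    simp [y, hfg] at h1

/-- Passing from lines to their cone loses nothing: by `hcomap` the vanishing ideal of the cone is
generated by images of homogeneous polynomials. -/
theorem schonIdeal_eq_vanishingIdeal (hne : ∃ x ∈ E.schonCone e κ, x ≠ 0)
    (hcomap : (vanishingIdeal κ (E.schonCone e κ)).comap (E.outerSubst κ e) =
      stanleyReisnerIdeal κ E.dualComplex ⊔ Ideal.span {∑ f, X f}) :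
    E.schonIdeal κ e = vanishingIdeal κ (E.schonCone e κ) := by
  apply le_antisymm
  · rw [schonIdeal, projVanishingIdeal, Ideal.span_le]
    rintro q ⟨⟨n, hn⟩, hq⟩
    have key : ∀ x ∈ E.schonCone e κ, x ≠ 0 → eval x q = 0 := by
      intro x hx hx0
      obtain ⟨a, ha⟩ := Projectivization.exists_smul_eq_mk_rep κ x hx0
      have h := hq (Projectivization.mk κ x hx0) ((E.mem_schonEmbedding_iff e _).mpr
        (ha ▸ E.smul_mem_schonCone e hx (a : κ)))
      rw [← ha, Units.smul_def, hn.eval_smul] at h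
      exact (mul_eq_zero.mp h).resolve_left (pow_ne_zero _ a.ne_zero)
    rw [SetLike.mem_coe, mem_vanishingIdeal_iff]
    intro x hx
    rw [aeval_eq_eval]
    by_cases hx0 : x = 0
    -- Degree 0 is the delicate case: a constant vanishing on the projective set vanishes at the
    -- origin only because that set is nonempty.
    · obtain ⟨y, hy, hy0⟩ := hne
      rw [hx0, ← zero_smul κ y, hn.eval_smul, key y hy hy0, mul_zero]
    · exact key x hx hx0
  · rw [← Ideal.map_comap_of_surjective _ (E.outerSubst_surjective e)
      (vanishingIdeal κ (E.schonCone e κ)), Ideal.map_le_iff_le_comap, hcomap]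
    refine sup_le ?_ ?_
    · rw [stanleyReisnerIdeal, Ideal.span_le]
      rintro _ ⟨s, hs, hsM, rfl⟩
      refine Ideal.subset_span ⟨⟨∑ i ∈ s, 1, ?_⟩, fun p hp => ?_⟩
      · rw [map_prod]
        refine IsHomogeneous.prod _ _ _ fun i _ => ?_
        by_cases hi : i = e
        · subst hi
          rw [outerSubst_X_outer]
          exact (IsHomogeneous.sum _ _ _ fun f _ => isHomogeneous_X κ f).neg
        · exact (E.outerSubst_X_interior (κ := κ) e ⟨i, hi⟩) ▸ isHomogeneous_X κ _
      · have hmem : ∏ i ∈ s, X i ∈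
            (vanishingIdeal κ (E.schonCone e κ)).comap (E.outerSubst κ e) := by
          rw [hcomap]
          exact Ideal.mem_sup_left (Ideal.subset_span ⟨s, hs, hsM, rfl⟩)
        have := mem_vanishingIdeal_iff.mp hmem p.rep ((E.mem_schonEmbedding_iff e p).mp hp)
        rwa [aeval_eq_eval] at this
    · rw [Ideal.span_singleton_le_iff_mem, Ideal.mem_comap, outerSubst_sum]
      exact Ideal.zero_mem _

end Schon

/-! ### Faces around vertices of the embedded graph -/

section Combinatorics

variable {V : Type*} {G : SimpleGraph V} (E : PlanarEmbedding G)

theorem fst_rot (d : G.Dart) : (E.rot d).fst = d.fst :=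
  (E.sameCycle_iff _ _).mp ((Equiv.Perm.sameCycle_apply_left).mpr (Equiv.Perm.SameCycle.refl _ _))

/-- Face tracing sends the dart from `u` to `v` to a dart leaving `v` on the same face. -/
theorem exists_inc_inc_of_adj {u v : V} (h : G.Adj u v) : ∃ f, E.Inc u f ∧ E.Inc v f := by
  let d : G.Dart := ⟨(u, v), h⟩
  refine ⟨E.faceOf d, ⟨d, rfl, rfl⟩, SimpleGraph.facePerm E.rot d, E.fst_rot d.symm, ?_⟩
  exact Quotient.sound
    (Equiv.Perm.sameCycle_apply_left.mpr (Equiv.Perm.SameCycle.refl _ _))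

theorem reflTransGen_common_face (hG : G.Connected) (v w : V) :
    Relation.ReflTransGen (fun v w => ({f | E.Inc v f} ∩ {f | E.Inc w f}).Nonempty) v w :=
  Relation.ReflTransGen.mono (r := G.Adj) (fun _ _ h => E.exists_inc_inc_of_adj h) _ _
    ((G.reachable_iff_reflTransGen v w).mp (hG.preconnected v w))

/-- A connected embedded graph with more than one face has a vertex that is incident with more than
one face. -/
theorem exists_inc_inc_ne (hG : G.Connected) [Nontrivial E.Face] :
    ∃ v f g, f ≠ g ∧ E.Inc v f ∧ E.Inc v g := by
  by_contra! hcon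
  obtain ⟨f, g, hfg⟩ := exists_pair_ne E.Face
  obtain ⟨v, hv⟩ := E.exists_inc f
  obtain ⟨w, hw⟩ := E.exists_inc g
  -- If each vertex met only one face, incidence with `f` would propagate along a path from `v` to
  -- `w`.
  refine hcon w f g hfg ?_ hw
  have := E.reflTransGen_common_face hG v w
  clear hw
  induction this with
  | refl => exact hv
  | @tail b c _ hbc ih =>
    obtain ⟨k, hb, hc⟩ := hbc
    have hk : f = k := by
      by_contra hne
      exact hcon b f k hne ih hb
    exact hk ▸ hc

/-- Combining `3 #V = 2 #E` with Euler's formula gives `#F = #V / 2 + 2`. -/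
theorem nontrivial_face [Fintype V] [DecidableRel G.Adj] (hreg : G.IsRegularOfDegree 3) :
    Nontrivial E.Face := by
  classical
  by_contra hcon
  have : Subsingleton E.Face := not_nontrivial_iff_subsingleton.mp hcon
  have hF : Nat.card E.Face ≤ 1 := Finite.card_le_one_iff_subsingleton.mpr this
  have heuler : Nat.card V + Nat.card E.Face = Nat.card G.edgeSet + 2 := E.euler
  have hdeg := G.sum_degrees_eq_twice_card_edges
  simp only [hreg.degree_eq, Finset.sum_const, Finset.card_univ, smul_eq_mul] at hdeg
  rw [Nat.card_eq_fintype_card, Nat.card_eq_fintype_card (α := G.edgeSet),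
    ← SimpleGraph.edgeFinset_card] at heuler
  omega

end Combinatorics

end PlanarEmbedding

theorem SimpleGraph.IsThreeConnected.connected {V : Type*} [Fintype V] {G : SimpleGraph V}
    (h : G.IsThreeConnected) : G.Connected := by
  have h0 := h.2 ∅ (by simp)
  have : {v : V | v ∉ (∅ : Finset V)} = Set.univ := by simp
  rw [this] at h0
  exact (SimpleGraph.induceUnivIso G).connected_iff.mp h0

/-! ### Comparison with the polytope -/

namespace Polytope3

/-- A nonempty intersection of facets contains a vertex of the polytope. -/
theorem exists_extremePoint_mem_facets {P : Set (EuclideanSpace ℝ (Fin 3))} (hP : IsPolytope P)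
    {s : Finset (Facet P)} (hs : s.Nonempty) {x : EuclideanSpace ℝ (Fin 3)}
    (hx : ∀ Q ∈ s, x ∈ Q.1) : ∃ y ∈ P.extremePoints ℝ, ∀ Q ∈ s, y ∈ Q.1 := by
  classical
  obtain ⟨S, hS, rfl⟩ := hP.1
  have hexp : IsExposed ℝ (convexHull ℝ S) (⋂₀ (s.image Subtype.val : Finset (Set _))) := by
    refine IsExposed.sInter (hs.image _) fun B hB => ?_
    obtain ⟨Q, -, rfl⟩ := Finset.mem_image.mp hB
    exact Q.2.1
  have hmem : ∀ y, y ∈ ⋂₀ ((s.image Subtype.val : Finset (Set _)) : Set (Set _)) ↔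
      ∀ Q ∈ s, y ∈ Q.1 := by
    intro y
    exact ⟨fun h Q hQ => h _ (Finset.mem_coe.mpr (Finset.mem_image_of_mem _ hQ)), fun h B hB => by
      obtain ⟨Q, hQ, rfl⟩ := Finset.mem_image.mp (Finset.mem_coe.mp hB)
      exact h Q hQ⟩
  -- The intersection is a nonempty compact exposed face, so it has an extreme point, which is also
  -- extreme in the polytope.
  obtain ⟨y, hy⟩ := (hexp.isCompact (hS.isCompact_convexHull ℝ)).extremePoints_nonempty
    ⟨x, (hmem x).mpr hx⟩
  exact ⟨y, hexp.isExtreme.extremePoints_subset_extremePoints hy, (hmem y).mp hy.1⟩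

theorem Realization.mem_dualComplex_iff {V : Type*} {G : SimpleGraph V} {E : PlanarEmbedding G}
    {P : Set (EuclideanSpace ℝ (Fin 3))} (r : Realization E P) (s : Finset E.Face) :
    s ∈ E.dualComplex ↔ s.map r.facet.toEmbedding ∈ dualComplex P := by
  constructor
  · rintro ⟨hs, v, hv⟩
    refine ⟨hs.map, r.vertex v, fun Q hQ => ?_⟩
    obtain ⟨f, hf, rfl⟩ := Finset.mem_map.mp hQ
    exact (r.inc_iff v f).mp (hv f hf)
  · rintro ⟨hs, x, hx⟩
    obtain ⟨y, hy, hyQ⟩ := exists_extremePoint_mem_facets r.isPolytope hs hx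
    refine ⟨Finset.map_nonempty.mp hs, r.vertex.symm ⟨y, hy⟩, fun f hf => ?_⟩
    rw [r.inc_iff, Equiv.apply_symm_apply]
    exact hyQ _ (Finset.mem_map_of_mem _ hf)

end Polytope3

/-! ### Assembly of the proposition -/

theorem proposition3p1 (κ : Type*) [Field κ] [IsAlgClosed κ]
    {V : Type*} [Fintype V] (G : SimpleGraph V) [DecidableRel G.Adj]
    (hreg : G.IsRegularOfDegree 3) (hconn : G.IsThreeConnected)
    (E : PlanarEmbedding G) (e : E.Face) :
    -- `M = E.dualComplex` is the dual complex of any polytope whose boundary is the embedded graph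
    (∀ (P : Set (EuclideanSpace ℝ (Fin 3))) (r : Polytope3.Realization E P) (s : Finset E.Face),
      s ∈ E.dualComplex ↔ s.map r.facet.toEmbedding ∈ Polytope3.dualComplex P) ∧
    -- the hyperplane section of the Stanley–Reisner scheme of `M` is reduced,
    (stanleyReisnerIdeal κ E.dualComplex ⊔
      Ideal.span {∑ f : E.Face, MvPolynomial.X f}).IsRadical ∧
    -- and it is the schön embedding
    (E.schonIdeal κ e).IsRadical ∧
    (E.schonIdeal κ e).comap (E.outerSubst κ e) =
      stanleyReisnerIdeal κ E.dualComplex ⊔ Ideal.span {∑ f : E.Face, MvPolynomial.X f} ∧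
    -- the substituted minimal monomial generators are a minimal generating set
    IsMinimalGeneratingSet
      (E.outerSubst κ e '' minimalMonomialGenerators (stanleyReisnerIdeal κ E.dualComplex))
      (E.schonIdeal κ e) := by
  have hG := hconn.connected
  have : Nonempty V := hG.nonempty
  have : Infinite κ := IsAlgClosed.instInfinite
  have hinc : ∀ v, ∃ f, E.Inc v f := by
    intro v
    obtain ⟨w, hw⟩ := (G.degree_pos_iff_exists_adj v).mp (by rw [hreg.degree_eq]; norm_num)
    exact (E.exists_inc_inc_of_adj hw).imp fun _ h => h.1
  have := E.nontrivial_face hreg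
  obtain ⟨v₀, f, g, hfg, hf, hg⟩ := E.exists_inc_inc_ne hG
  have hSR : stanleyReisnerIdeal κ E.dualComplex = ⨅ v, coordIdeal κ {f | E.Inc v f} :=
    stanleyReisnerIdeal_incidenceComplex E.Inc E.exists_inc
  have hcomap : (vanishingIdeal κ (E.schonCone e κ)).comap (E.outerSubst κ e) =
      stanleyReisnerIdeal κ E.dualComplex ⊔ Ideal.span {∑ f, X f} := by
    rw [E.comap_vanishingIdeal_schonCone e hinc, hSR]
    exact le_antisymm (iInf_coordIdeal_sup_sum_le _ (E.reflTransGen_common_face hG))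
      (le_iInf fun v => sup_le_sup_right (iInf_le _ v) _)
  have hsch := E.schonIdeal_eq_vanishingIdeal e
    (E.exists_ne_zero_mem_schonCone (κ := κ) e hfg hf hg) hcomap
  have hrad : (E.schonIdeal κ e).IsRadical := by
    rw [hsch]
    rintro p ⟨n, hn⟩
    rw [mem_vanishingIdeal_iff] at hn ⊢
    intro x hx
    exact eq_zero_of_pow_eq_zero (by rw [← map_pow]; exact hn x hx)
  have hcomap' : (E.schonIdeal κ e).comap (E.outerSubst κ e) =
      stanleyReisnerIdeal κ E.dualComplex ⊔ Ideal.span {∑ f, X f} := by rw [hsch, hcomap]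
  refine ⟨fun P r s => r.mem_dualComplex_iff s, hcomap' ▸ hrad.comap _, hrad, hcomap', ?_⟩
  -- The substitution is surjective and kills `l`, so applying it to `hcomap'` leaves only the image
  -- of the Stanley–Reisner ideal.
  have hmap : E.schonIdeal κ e =
      (stanleyReisnerIdeal κ E.dualComplex).map (E.outerSubst κ e) := by
    have h := Ideal.map_comap_of_surjective (E.outerSubst κ e) (E.outerSubst_surjective e)
      (E.schonIdeal κ e)
    rw [hcomap', Ideal.map_sup, Ideal.map_span, Set.image_singleton, E.outerSubst_sum,
      Ideal.span_singleton_zero, sup_bot_eq] at h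
    exact h.symm
  rw [hmap, hSR]
  exact isMinimalGeneratingSet_image_minimalMonomialGenerators
    (fun p hp a ha => monomial_mem_iInf_coordIdeal hp ha) (l := ∑ f, X f) (by simp [coeff_sum])
    (fun q hq => sum_X_mul_mem_iInf_coordIdeal hinc hq) (E.outerSubst κ e)
    (E.outerSubst_surjective e) (fun q hq => E.sum_dvd_of_outerSubst_eq_zero e hq)
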